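/- Let $X$ be a standard Gaussian random vector in $\mathbb R^d$, let $X_1,X_2,\dots$ be i.i.d. standard Gaussian random vectors in $\mathbb R^d$, let $h:\mathbb R^d\to\mathbb R$ be Borel measurable, $\gamma\in\mathbb R$, and let $\theta\in\mathbb R^d$ be fixed. Write $$Y=h(X),\qquad Y^\theta=h(X+\theta),\qquad \mathcal E^\theta=e^{-\theta\cdot X-|\theta|^2/2}.$$ Assume that $\mathbb P(Y>\gamma)>0$ and $\mathbb E\big[(Y^\theta\mathbf 1_{\{Y^\theta>\gamma\}}\mathcal E^\theta)^2\big]<\infty$. Let $$\mathrm{CVaR}=\mathbb E[h(X)\mid h(X)>\gamma],\qquad \mathrm{CVaR}_n=\frac{\sum_{i=1}^n h(X_i+\theta)\mathbf 1_{\{h(X_i+\theta)>\gamma\}}e^{-\theta\cdot X_i-|\theta|^2/2}}{\sum_{i=1}^n \mathbf 1_{\{h(X_i+\theta)>\gamma\}}e^{-\theta\cdot X_i-|\theta|^2/2}},$$ with the convention $0/0=0$. Then all the expectations occurring in this statement are finite, and, as $n\to\infty$, $$\sqrt n\,(\mathrm{CVaR}_n-\mathrm{CVaR})\ \xrightarrow{\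 \mathcal L\ }\ \mathcal N(0,\sigma^2),$$ where $\mathcal N(0,0)$ is the Dirac mass at $0$ and $\sigma^2\ge 0$ is given by $$\sigma^2=\frac{\mathrm{Var}\big(Y^\theta\mathbf 1_{\{Y^\theta>\gamma\}}\mathcal E^\theta\big)}{\mathbb P(Y>\gamma)^2}-2\,\frac{\mathbb E[Y\mathbf 1_{\{Y>\gamma\}}]}{\mathbb P(Y>\gamma)^3}\,\mathbb E\big[Y^\theta\mathbf 1_{\{Y^\theta>\gamma\}}(\mathcal E^\theta)^2\big]+\frac{\mathbb E[Y\mathbf 1_{\{Y>\gamma\}}]^2}{\mathbb P(Y>\gamma)^3}\left(\frac{\mathbb E\big[\mathbf 1_{\{Y^\theta>\gamma\}}(\mathcal E^\theta)^2\big]}{\mathbb P(Y>\gamma)}+\mathbb P(Y>\gamma)\right).$$ -/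

import Mathlib

open MeasureTheory ProbabilityTheory Filter
open scoped ENNReal

noncomputable section

namespace CVaR

/-- The indicator `1_{y > γ}`, as a real number. -/
def exceed (γ y : ℝ) : ℝ := (Set.Ioi γ).indicator (fun _ => (1 : ℝ)) y

/-- The Gaussian mean-shift likelihood ratio `exp (-θ · x - |θ|² / 2)`. -/
def weight {d : ℕ} (θ x : EuclideanSpace ℝ (Fin d)) : ℝ :=
  Real.exp (-inner ℝ θ x - ‖θ‖ ^ 2 / 2)

/-- The expected shortfall `E[Y | Y > γ]`: the mean of `Y` under `P` conditioned on the event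
`{Y > γ}`. -/
def expectedShortfall {Ω : Type*} [MeasurableSpace Ω] (P : Measure Ω) (Y : Ω → ℝ) (γ : ℝ) : ℝ :=
  ∫ ω, Y ω ∂(P[|{ω | γ < Y ω}])

/-- The importance-sampling ratio estimator built from the first `n` samples of the sequence `x`
(its value is `0` when no sample satisfies `h (x i + θ) > γ`). -/
def estimator {d : ℕ} (h : EuclideanSpace ℝ (Fin d) → ℝ) (γ : ℝ) (θ : EuclideanSpace ℝ (Fin d))
    (n : ℕ) (x : ℕ → EuclideanSpace ℝ (Fin d)) : ℝ :=
  (∑ i ∈ Finset.range n, h (x i + θ) * exceed γ (h (x i + θ)) * weight θ (x i)) /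
    (∑ i ∈ Finset.range n, exceed γ (h (x i + θ)) * weight θ (x i))

/-- The asymptotic variance; here `p = P(Y > γ)` and `m = E[Y 1_{Y > γ}]` with `Y = h(X)`. -/
def asymptoticVariance {Ω : Type*} [MeasurableSpace Ω] (P : Measure Ω) {d : ℕ}
    (X : Ω → EuclideanSpace ℝ (Fin d)) (h : EuclideanSpace ℝ (Fin d) → ℝ) (γ : ℝ)
    (θ : EuclideanSpace ℝ (Fin d)) : ℝ :=
  let p : ℝ := P.real {ω | γ < h (X ω)}
  let m : ℝ := ∫ ω, h (X ω) * exceed γ (h (X ω)) ∂P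
  variance (fun ω => h (X ω + θ) * exceed γ (h (X ω + θ)) * weight θ (X ω)) P / p ^ 2
    - 2 * (m / p ^ 3) *
      (∫ ω, h (X ω + θ) * exceed γ (h (X ω + θ)) * weight θ (X ω) ^ 2 ∂P)
    + m ^ 2 / p ^ 3 *
      ((∫ ω, exceed γ (h (X ω + θ)) * weight θ (X ω) ^ 2 ∂P) / p + p)

end CVaR

end

namespace CVaR

/-! Put `B = 1_{Y^θ > γ} ℰ^θ` and `A = Y^θ B`. By Cameron–Martin (`map_add_withDensity_weight`)
their means are `m = E[Y 1_{Y > γ}]` and `p = P(Y > γ)`, so CVaR is `m / p` and the estimator is `∑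
A_i / ∑ B_i`. Once `∑ B_i ≠ 0`, the error is `n^{-1/2} ∑ (A_i - (m/p) B_i)` times `n / ∑ B_i`: the
CLT handles the first, centred factor, the strong law the second, and Slutsky gives variance `Var(A
- (m/p) B) / p²`, which `variance_sub_ratio_mul` expands. -/

/-- **Delta method for a ratio of empirical means**: the ratio of two empirical sums of an i.i.d.
sample is asymptotically normal around the ratio of the means. -/
theorem tendstoInDistribution_ratio {Ω E : Type*} [MeasurableSpace Ω] [MeasurableSpace E]
    {P : Measure Ω} [IsProbabilityMeasure P] {X : Ω → E} {Xs : ℕ → Ω → E}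
    (hident : ∀ i, IdentDistrib (Xs i) X P P) (hindep : iIndepFun Xs P) {f g : E → ℝ}
    (hf : Measurable f) (hg : Measurable g) (hf2 : MemLp (fun ω => f (X ω)) 2 P)
    (hg2 : MemLp (fun ω => g (X ω)) 2 P) {m p : ℝ} (hm : ∫ ω, f (X ω) ∂P = m)
    (hp : ∫ ω, g (X ω) ∂P = p) (hp0 : p ≠ 0) :
    TendstoInDistribution
      (fun (n : ℕ) ω => √(n : ℝ) * ((∑ i ∈ Finset.range n, f (Xs i ω)) /
        (∑ i ∈ Finset.range n, g (Xs i ω)) - m / p))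
      atTop (fun z : ℝ => z) (fun _ => P)
      (gaussianReal 0 (Var[fun ω => f (X ω) - m / p * g (X ω); P] / p ^ 2).toNNReal) := by
  set v := Var[fun ω => f (X ω) - m / p * g (X ω); P] with hv
  have hv0 : 0 ≤ v := variance_nonneg _ _
  have hk : Measurable fun x => f x - m / p * g x := by fun_prop
  have hZident (i : ℕ) : IdentDistrib (fun ω => f (Xs i ω) - m / p * g (Xs i ω))
      (fun ω => f (X ω) - m / p * g (X ω)) P P := (hident i).comp hk
  have hgident (i : ℕ) : IdentDistrib (fun ω => g (Xs i ω)) (fun ω => g (X ω)) P P :=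
    (hident i).comp hg
  have hAm (i : ℕ) : AEMeasurable (fun ω => f (Xs i ω)) P :=
    hf.comp_aemeasurable (hident i).aemeasurable_fst
  have hBm (i : ℕ) : AEMeasurable (fun ω => g (Xs i ω)) P :=
    hg.comp_aemeasurable (hident i).aemeasurable_fst
  have hZmean : ∫ ω, f (Xs 0 ω) - m / p * g (Xs 0 ω) ∂P = 0 := by
    rw [(hZident 0).integral_eq, integral_sub (hf2.integrable (by norm_num))
      ((hg2.integrable (by norm_num)).const_mul _), integral_const_mul, hm, hp]
    field_simp
    ring
  -- The CLT limit is realised as `z * p` with `z` following the target law, so that Slutsky's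
  -- factor `p⁻¹` leaves exactly `z`.
  have hlaw : HasLaw (fun z : ℝ => z * p)
      (gaussianReal 0 Var[fun ω => f (Xs 0 ω) - m / p * g (Xs 0 ω); P].toNNReal)
      (gaussianReal 0 (v / p ^ 2).toNNReal) := by
    refine ⟨by fun_prop, ?_⟩
    rw [gaussianReal_map_mul_const, (hZident 0).variance_eq, ← hv, mul_zero]
    congr 1
    ext
    rw [NNReal.coe_mul, Real.coe_toNNReal _ (by positivity), Real.coe_toNNReal _ hv0]
    simp only [NNReal.coe_mk]
    field_simp
  have hclt := tendstoInDistribution_inv_sqrt_mul_sum_sub (P := P)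
    (X := fun i ω => f (Xs i ω) - m / p * g (Xs i ω)) hlaw
    ((hZident 0).memLp_iff.2 (hf2.sub (hg2.const_mul _)))
    (hindep.comp (fun _ x => f x - m / p * g x) fun _ => hk)
    (fun i => (hZident i).trans (hZident 0).symm)
  simp only [hZmean, mul_zero, sub_zero] at hclt
  have hslln : ∀ᵐ ω ∂P, Tendsto (fun n : ℕ => (∑ i ∈ Finset.range n, g (Xs i ω)) / n) atTop
      (nhds p) := by
    have := strong_law_ae_real (μ := P) (fun i ω => g (Xs i ω))
      ((hgident 0).integrable_iff.2 (hg2.integrable (by norm_num)))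
      (fun i j hij => (hindep.indepFun hij).comp hg hg)
      (fun i => (hgident i).trans (hgident 0).symm)
    rwa [(hgident 0).integral_eq, hp] at this
  have hinv : TendstoInMeasure P
      (fun (n : ℕ) ω => ((∑ i ∈ Finset.range n, g (Xs i ω)) / n)⁻¹) atTop (fun _ => p⁻¹) := by
    refine tendstoInMeasure_of_tendsto_ae (fun n => ?_) ?_
    · exact ((Finset.aemeasurable_fun_sum _ fun i _ => hBm i).div_const _).inv.aestronglyMeasurable
    · filter_upwards [hslln] with ω hω using hω.inv₀ hp0
  have hprod := hclt.continuous_comp_prodMk_of_tendstoInMeasure_const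
    (g := fun q : ℝ × ℝ => q.1 * q.2) (by fun_prop) hinv
    (fun n => ((Finset.aemeasurable_fun_sum _ fun i _ => hBm i).div_const _).inv)
  simp only [mul_assoc, mul_inv_cancel₀ hp0, mul_one] at hprod
  have hYm (n : ℕ) : AEMeasurable (fun ω => √(n : ℝ) * ((∑ i ∈ Finset.range n, f (Xs i ω)) /
      (∑ i ∈ Finset.range n, g (Xs i ω)) - m / p)) P :=
    (((Finset.aemeasurable_fun_sum _ fun i _ => hAm i).div
      (Finset.aemeasurable_fun_sum _ fun i _ => hBm i)).sub_const _).const_mul _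
  refine tendstoInDistribution_of_tendstoInMeasure_sub _ _ hprod ?_ hYm
  · refine tendstoInMeasure_of_tendsto_ae (fun n => ?_) ?_
    · exact ((hYm n).sub (hprod.forall_aemeasurable n)).aestronglyMeasurable
    · filter_upwards [hslln] with ω hω
      -- Almost surely the two sequences agree as soon as the denominator is nonzero, so the value
      -- given to `0/0` is irrelevant.
      refine tendsto_const_nhds.congr' ?_
      filter_upwards [hω.eventually_ne hp0, eventually_gt_atTop 0] with n hn hn0
      have hn' : (0 : ℝ) < n := by exact_mod_cast hn0
      have hS : ∑ i ∈ Finset.range n, g (Xs i ω) ≠ 0 := fun h => hn (by simp [h])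
      simp only [Pi.sub_apply, Pi.zero_apply, Finset.sum_sub_distrib, ← Finset.mul_sum]
      have hsq : √(n : ℝ) * √(n : ℝ) = n := Real.mul_self_sqrt hn'.le
      have hs0 : √(n : ℝ) ≠ 0 := (Real.sqrt_pos.2 hn').ne'
      generalize √(n : ℝ) = s at hsq hs0 ⊢
      rw [inv_div, ← hsq]
      field_simp
      ring

theorem measurable_weight {d : ℕ} (θ : EuclideanSpace ℝ (Fin d)) : Measurable (weight θ) := by
  unfold weight
  fun_prop

theorem weight_pos {d : ℕ} (θ x : EuclideanSpace ℝ (Fin d)) : 0 < weight θ x := Real.exp_pos _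

/-- The squared weight is a constant times `exp (-2 θ · x)`, and `θ · x` is a real Gaussian, with
all exponential moments. -/
theorem memLp_weight {d : ℕ} (θ : EuclideanSpace ℝ (Fin d)) :
    MemLp (weight θ) 2 (stdGaussian (EuclideanSpace ℝ (Fin d))) := by
  rw [memLp_two_iff_integrable_sq (measurable_weight θ).aestronglyMeasurable]
  have h := integrable_exp_mul_gaussianReal (-2)
    (μ := ∫ x, innerSL ℝ θ x ∂(stdGaussian (EuclideanSpace ℝ (Fin d))))
    (v := Var[innerSL ℝ θ; stdGaussian (EuclideanSpace ℝ (Fin d))].toNNReal)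
  rw [← IsGaussian.map_eq_gaussianReal, integrable_map_measure (by fun_prop) (by fun_prop)] at h
  refine (h.mul_const (Real.exp (-‖θ‖ ^ 2))).congr (ae_of_all _ fun x => ?_)
  simp only [Function.comp_apply, innerSL_apply_apply, weight, ← Real.exp_add, ← Real.exp_nat_mul]
  congr 1
  push_cast
  ring

/-- **Cameron–Martin formula** for the standard Gaussian measure. -/
theorem map_add_withDensity_weight {d : ℕ} (θ : EuclideanSpace ℝ (Fin d)) :
    ((stdGaussian (EuclideanSpace ℝ (Fin d))).withDensity
      (fun x => ENNReal.ofReal (weight θ x))).map (· + θ) =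
      stdGaussian (EuclideanSpace ℝ (Fin d)) := by
  have hfin := isFiniteMeasure_withDensity_ofReal
    ((memLp_weight θ).integrable (by norm_num)).hasFiniteIntegral
  refine Measure.ext_of_charFun (funext fun t => ?_)
  rw [charFun_stdGaussian, charFun_apply, integral_map (by fun_prop) (by fun_prop),
    integral_withDensity_eq_integral_toReal_smul (measurable_weight θ).ennreal_ofReal (by simp)]
  simp only [ENNReal.toReal_ofReal (weight_pos θ _).le]
  rw [← map_pi_eq_stdGaussian, integral_map (by fun_prop)
    (by have := measurable_weight θ; fun_prop)]
  -- The integrand splits over coordinates. With `z = i t_j - θ_j`, the Gaussian integral `exp (z² /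
  -- 2)` cancels the prefactor and leaves `exp (-t_j² / 2)`.
  have key (x : Fin d → ℝ) : weight θ (WithLp.toLp 2 x) •
      Complex.exp ((inner ℝ (WithLp.toLp 2 x + θ) t : ℝ) * Complex.I) =
      ∏ i, Complex.exp (t i * θ i * Complex.I - θ i ^ 2 / 2) *
        Complex.exp ((t i * Complex.I - θ i) * x i) := by
    simp only [← Complex.exp_add, ← Complex.exp_sum, weight, Complex.real_smul,
      Complex.ofReal_exp, EuclideanSpace.real_norm_sq_eq, PiLp.inner_apply]
    congr 1
    simp only [RCLike.inner_apply, conj_trivial, PiLp.add_apply]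
    push_cast
    rw [← Finset.sum_neg_distrib, Finset.sum_div, Finset.sum_mul, ← Finset.sum_sub_distrib,
      ← Finset.sum_add_distrib]
    exact Finset.sum_congr rfl fun i _ => by ring
  simp only [key]
  rw [integral_fintype_prod_eq_prod (f := fun i (x : ℝ) =>
    Complex.exp (t i * θ i * Complex.I - θ i ^ 2 / 2) *
        Complex.exp ((t i * Complex.I - θ i) * x))]
  have h1 (z : ℂ) : ∫ x : ℝ, Complex.exp (z * x) ∂(gaussianReal 0 1) = Complex.exp (z ^ 2 / 2) := by
    simpa [complexMGF] using complexMGF_id_gaussianReal (μ := 0) (v := 1) z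
  simp only [integral_const_mul, h1]
  simp only [← Complex.exp_add, ← Complex.exp_sum]
  congr 1
  rw [← Complex.ofReal_pow, EuclideanSpace.real_norm_sq_eq]
  push_cast
  rw [← Finset.sum_neg_distrib, Finset.sum_div]
  refine Finset.sum_congr rfl fun i _ => ?_
  ring_nf
  rw [Complex.I_sq]
  ring

theorem measurable_exceed (γ : ℝ) : Measurable (exceed γ) :=
  measurable_const.indicator measurableSet_Ioi

theorem exceed_mul_self (γ y : ℝ) : exceed γ y * exceed γ y = exceed γ y := by
  by_cases hy : y ∈ Set.Ioi γ <;> simp [exceed, hy]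

theorem exceed_nonneg (γ y : ℝ) : 0 ≤ exceed γ y :=
  Set.indicator_nonneg (fun _ _ => zero_le_one) _

theorem exceed_le_one (γ y : ℝ) : exceed γ y ≤ 1 :=
  Set.indicator_le_self' (fun _ _ => zero_le_one) _

theorem exceed_comp {Ω : Type*} (γ : ℝ) (Y : Ω → ℝ) :
    (fun ω => exceed γ (Y ω)) = {ω | γ < Y ω}.indicator 1 := by
  ext ω
  by_cases hω : γ < Y ω <;> simp [exceed, hω]

theorem mul_exceed_comp {Ω : Type*} (γ : ℝ) (Y : Ω → ℝ) :
    (fun ω => Y ω * exceed γ (Y ω)) = {ω | γ < Y ω}.indicator Y := by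
  ext ω
  by_cases hω : γ < Y ω <;> simp [exceed, hω]

section shift

variable {d : ℕ} {Ω : Type*} [MeasurableSpace Ω] {P : Measure Ω}
  {X : Ω → EuclideanSpace ℝ (Fin d)}

theorem integrable_shift_iff
    (hX : HasLaw X (stdGaussian (EuclideanSpace ℝ (Fin d))) P)
    {k : EuclideanSpace ℝ (Fin d) → ℝ} (hk : Measurable k) (θ : EuclideanSpace ℝ (Fin d)) :
    Integrable (fun ω => k (X ω + θ) * weight θ (X ω)) P ↔ Integrable (fun ω => k (X ω)) P := by
  have hw := measurable_weight θ
  have hm : Measurable fun x => k (x + θ) * weight θ x := by fun_prop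
  rw [← Function.comp_def (fun x => k (x + θ) * weight θ x) X, ← Function.comp_def k X,
    ← integrable_map_measure hm.aestronglyMeasurable hX.aemeasurable,
    ← integrable_map_measure hk.aestronglyMeasurable hX.aemeasurable, hX.map_eq]
  nth_rewrite 2 [← map_add_withDensity_weight θ]
  rw [integrable_map_measure hk.aestronglyMeasurable (by fun_prop),
    integrable_withDensity_iff_integrable_smul' hw.ennreal_ofReal (by simp)]
  simp [ENNReal.toReal_ofReal (weight_pos θ _).le, mul_comm]

theorem integral_shift
    (hX : HasLaw X (stdGaussian (EuclideanSpace ℝ (Fin d))) P)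
    {k : EuclideanSpace ℝ (Fin d) → ℝ} (hk : Measurable k) (θ : EuclideanSpace ℝ (Fin d)) :
    ∫ ω, k (X ω + θ) * weight θ (X ω) ∂P = ∫ ω, k (X ω) ∂P := by
  have hw := measurable_weight θ
  have hm : Measurable fun x => k (x + θ) * weight θ x := by fun_prop
  rw [← Function.comp_def (fun x => k (x + θ) * weight θ x) X, ← Function.comp_def k X,
    hX.integral_comp hm.aestronglyMeasurable, hX.integral_comp hk.aestronglyMeasurable]
  nth_rewrite 2 [← map_add_withDensity_weight θ]
  rw [integral_map (by fun_prop) hk.aestronglyMeasurable,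
    integral_withDensity_eq_integral_toReal_smul hw.ennreal_ofReal (by simp)]
  simp [ENNReal.toReal_ofReal (weight_pos θ _).le, mul_comm]

end shift

/-- Bilinear expansion: the products of means contribute `2 m²/p²` from the covariance and `-m²/p²`
from `Var[B]`, whence the final `+ p`. -/
theorem variance_sub_ratio_mul {Ω : Type*} [MeasurableSpace Ω] {P : Measure Ω}
    [IsProbabilityMeasure P] {A B : Ω → ℝ} (hA : MemLp A 2 P) (hB : MemLp B 2 P) {m p : ℝ}
    (hm : ∫ ω, A ω ∂P = m) (hp : ∫ ω, B ω ∂P = p) (hp0 : p ≠ 0) :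
    Var[fun ω => A ω - m / p * B ω; P] / p ^ 2 =
      Var[A; P] / p ^ 2 - 2 * (m / p ^ 3) * (∫ ω, A ω * B ω ∂P)
        + m ^ 2 / p ^ 3 * ((∫ ω, B ω ^ 2 ∂P) / p + p) := by
  have hAB : cov[A, B; P] = ∫ ω, A ω * B ω ∂P - m * p := by
    rw [covariance_eq_sub hA hB, hm, hp]; rfl
  have hBB : Var[B; P] = ∫ ω, B ω ^ 2 ∂P - p ^ 2 := by
    rw [variance_eq_sub hB, hp]; rfl
  rw [variance_fun_sub hA (hB.const_mul _), covariance_const_mul_right, variance_const_mul,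
    hAB, hBB]
  field_simp
  ring

end CVaR

theorem mainTheorem1 {d : ℕ} {Ω : Type*} [MeasurableSpace Ω] (P : Measure Ω)
    [IsProbabilityMeasure P]
    (X : Ω → EuclideanSpace ℝ (Fin d)) (hX : HasLaw X (stdGaussian (EuclideanSpace ℝ (Fin d))) P)
    (Xs : ℕ → Ω → EuclideanSpace ℝ (Fin d))
    (hXs : ∀ i, HasLaw (Xs i) (stdGaussian (EuclideanSpace ℝ (Fin d))) P)
    (hindep : iIndepFun Xs P)
    (h : EuclideanSpace ℝ (Fin d) → ℝ) (hh : Measurable h) (γ : ℝ)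
    (θ : EuclideanSpace ℝ (Fin d))
    (hpos : 0 < P {ω | γ < h (X ω)})
    (hL2 : MemLp
      (fun ω => h (X ω + θ) * CVaR.exceed γ (h (X ω + θ)) * CVaR.weight θ (X ω)) 2 P) :
    Integrable (fun ω => h (X ω)) (P[|{ω | γ < h (X ω)}]) ∧
    Integrable (fun ω => h (X ω) * CVaR.exceed γ (h (X ω))) P ∧
    Integrable
      (fun ω => h (X ω + θ) * CVaR.exceed γ (h (X ω + θ)) * CVaR.weight θ (X ω) ^ 2) P ∧
    Integrable (fun ω => CVaR.exceed γ (h (X ω + θ)) * CVaR.weight θ (X ω) ^ 2) P ∧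
    0 ≤ CVaR.asymptoticVariance P X h γ θ ∧
    TendstoInDistribution
      (fun (n : ℕ) (ω : Ω) =>
        √(n : ℝ) * (CVaR.estimator h γ θ n (fun i => Xs i ω) -
          CVaR.expectedShortfall P (fun ω' => h (X ω')) γ))
      atTop (fun z : ℝ => z) (fun _ => P)
      (gaussianReal 0 (CVaR.asymptoticVariance P X h γ θ).toNNReal) := by
  have hXm := hX.aemeasurable
  have hw := CVaR.measurable_weight θ
  have he := CVaR.measurable_exceed γ
  have hf : Measurable fun x => h (x + θ) * CVaR.exceed γ (h (x + θ)) * CVaR.weight θ x := by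
    fun_prop
  have hg : Measurable fun x => CVaR.exceed γ (h (x + θ)) * CVaR.weight θ x := by fun_prop
  have hhX : AEMeasurable (fun ω => h (X ω)) P := hh.comp_aemeasurable hXm
  have hs : NullMeasurableSet {ω | γ < h (X ω)} P :=
    nullMeasurableSet_lt aemeasurable_const hhX
  have hp0 : P.real {ω | γ < h (X ω)} ≠ 0 :=
    (ENNReal.toReal_pos hpos.ne' (measure_ne_top _ _)).ne'
  have hwX : MemLp (fun ω => CVaR.weight θ (X ω)) 2 P := by
    have := CVaR.memLp_weight θ
    rwa [← hX.map_eq, memLp_map_measure_iff hw.aestronglyMeasurable hXm] at this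
  have hg2 : MemLp (fun ω => CVaR.exceed γ (h (X ω + θ)) * CVaR.weight θ (X ω)) 2 P := by
    refine hwX.mono (hg.comp_aemeasurable hXm).aestronglyMeasurable (ae_of_all _ fun ω => ?_)
    rw [norm_mul, Real.norm_of_nonneg (CVaR.exceed_nonneg _ _)]
    exact mul_le_of_le_one_left (norm_nonneg _) (CVaR.exceed_le_one _ _)
  have hm := CVaR.integral_shift hX (k := fun x => h x * CVaR.exceed γ (h x)) (by fun_prop) θ
  have hp : ∫ ω, CVaR.exceed γ (h (X ω + θ)) * CVaR.weight θ (X ω) ∂P =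
      P.real {ω | γ < h (X ω)} := by
    rw [CVaR.integral_shift hX (k := fun x => CVaR.exceed γ (h x)) (by fun_prop) θ,
      CVaR.exceed_comp γ (fun ω => h (X ω)), integral_indicator₀ hs]
    simp
  have hint : Integrable (fun ω => h (X ω) * CVaR.exceed γ (h (X ω))) P :=
    (CVaR.integrable_shift_iff hX (k := fun x => h x * CVaR.exceed γ (h x)) (by fun_prop) θ).1
      (hL2.integrable (by norm_num))
  -- The indicator is idempotent, so only the weight gets squared.
  have hAB (ω : Ω) : h (X ω + θ) * CVaR.exceed γ (h (X ω + θ)) * CVaR.weight θ (X ω) *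
      (CVaR.exceed γ (h (X ω + θ)) * CVaR.weight θ (X ω)) =
      h (X ω + θ) * CVaR.exceed γ (h (X ω + θ)) * CVaR.weight θ (X ω) ^ 2 := by
    linear_combination h (X ω + θ) * CVaR.weight θ (X ω) ^ 2 *
      CVaR.exceed_mul_self γ (h (X ω + θ))
  have hBB (ω : Ω) : (CVaR.exceed γ (h (X ω + θ)) * CVaR.weight θ (X ω)) ^ 2 =
      CVaR.exceed γ (h (X ω + θ)) * CVaR.weight θ (X ω) ^ 2 := by
    linear_combination CVaR.weight θ (X ω) ^ 2 * CVaR.exceed_mul_self γ (h (X ω + θ))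
  have hvar := CVaR.variance_sub_ratio_mul hL2 hg2 hm hp hp0
  simp only [hAB, hBB] at hvar
  change _ = CVaR.asymptoticVariance P X h γ θ at hvar
  have hes : CVaR.expectedShortfall P (fun ω' => h (X ω')) γ =
      (∫ ω, h (X ω) * CVaR.exceed γ (h (X ω)) ∂P) / P.real {ω | γ < h (X ω)} := by
    rw [CVaR.expectedShortfall, ProbabilityTheory.cond, integral_smul_measure,
      CVaR.mul_exceed_comp γ (fun ω => h (X ω)), integral_indicator₀ hs, ENNReal.toReal_inv,
      smul_eq_mul, inv_mul_eq_div]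
    rfl
  refine ⟨?_, hint, ?_, ?_, ?_, ?_⟩
  · have hcongr : (fun ω => h (X ω) * CVaR.exceed γ (h (X ω)))
        =ᵐ[P.restrict {ω | γ < h (X ω)}] fun ω => h (X ω) := by
      filter_upwards [ae_restrict_mem₀ hs] with ω hω
      rw [CVaR.exceed, Set.indicator_of_mem (show h (X ω) ∈ Set.Ioi γ from hω), mul_one]
    exact (hint.restrict.congr hcongr).smul_measure
      (ENNReal.inv_ne_top.2 hpos.ne')
  · exact (hL2.integrable_mul hg2).congr (ae_of_all _ hAB)
  · exact hg2.integrable_sq.congr (ae_of_all _ hBB)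
  · exact hvar ▸ div_nonneg (variance_nonneg _ _) (sq_nonneg _)
  · rw [hes]
    simp only [← hvar]
    exact CVaR.tendstoInDistribution_ratio
      (fun i => ⟨(hXs i).aemeasurable, hXm, (hXs i).map_eq.trans hX.map_eq.symm⟩)
      hindep hf hg hL2 hg2 hm hp hp0
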